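/- A weighted undirected graph on $[n]$ is an assignment of non-negative real weights to the unordered pairs of distinct vertices of $[n]$. For a set $S\subseteq[n]$ its cut value $F_G(S)$ is the total weight of the edges with exactly one endpoint in $S$, and the max-cut value is $\mathrm{MC}(G)=\max_{S\subseteq[n]}F_G(S)$. A deterministic adaptive algorithm on $n$ vertices queries sets $S\subseteq [n]$ one after another, each time receiving $F_G(S)$; its next query, or its decision to stop and output a real number, may depend arbitrarily on the answers received so far. It \emph{estimates the max-cut value within a factor of $c$} if on every weighted undirected graph $G$ on $[n]$ it outputs a number $v$ with $c\cdot\mathrm{MC}(G)\le v\le \mathrm{MC}(G)$. The number of queries it uses is counted in the worst case over $G$. (1) Let $c\in(1/2,1)$, $\varepsilon\in(0,1)$ and $\alpha>0$ satisfy $c>\frac{1}{1+\varepsilon^2}$ and $\alpha<\frac{(1-\varepsilon)^3}{108(1+\varepsilon)}$. Then there is $N$ (depending only on $c,\varepsilon,\alpha$) such that for every $n\ge N$ no deterministic adaptive algorithm on $n$ vertices that makes at most $\alpha n$ cut queries on every graph estimates the max-cut value within a factor of $c$. (2) Let $c\in(1/2,1)$. Every deterministic adaptive algorithm on $n$ vertices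 that estimates the max-cut value within a factor of $c$ requires at least $$n\left(\frac{(\sqrt c-\sqrt{1-c})^4}{108\,c\,(2c-1)}-o(1)\right)$$ cut queries in the worst case, where the $o(1)$ term depends only on $c$ and $n$ and tends to $0$ as $n\to\infty$. (3) Consequently, for every $c>1/2$, the number of cut queries required by a deterministic adaptive algorithm that estimates the max-cut value within a factor of $c$ is $\Omega(n)$. -/

import Mathlib

open Filter Topology

/-- A weighted undirected graph on the vertex set `Fin n`: a symmetric non-negative real weight on
pairs of distinct vertices (weight `0` means that there is no edge). -/
structure WeightedGraph (n : ℕ) where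
  weight : Fin n → Fin n → ℝ
  symm : ∀ i j, weight i j = weight j i
  nonneg : ∀ i j, 0 ≤ weight i j
  loopless : ∀ i, weight i i = 0

namespace WeightedGraph

/-- The value of the cut `S`: the total weight of all edges with exactly one endpoint in `S`. -/
def cutValue {n : ℕ} (G : WeightedGraph n) (S : Finset (Fin n)) : ℝ :=
  ∑ i ∈ S, ∑ j ∈ Sᶜ, G.weight i j

/-- The max-cut value: the largest value of a cut. -/
noncomputable def maxCut {n : ℕ} (G : WeightedGraph n) : ℝ :=
  (Finset.univ : Finset (Finset (Fin n))).sup' Finset.univ_nonempty G.cutValue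

end WeightedGraph

/-- A deterministic adaptive algorithm for value estimation in the cut query model on `n` vertices:
it either stops and outputs a real number, or queries a vertex set and continues in a way that
depends arbitrarily on the answer (hence on all the answers so far). Computation is unlimited. -/
inductive CutQueryAlgorithm (n : ℕ) : Type where
  | output (value : ℝ) : CutQueryAlgorithm n
  | query (S : Finset (Fin n)) (next : ℝ → CutQueryAlgorithm n) : CutQueryAlgorithm n

namespace CutQueryAlgorithm

/-- The number output by the algorithm when all its queries are answered by the cut function
of `G`. -/
def result {n : ℕ} (G : WeightedGraph n) : CutQueryAlgorithm n → ℝ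
  | output value => value
  | query S next => (next (G.cutValue S)).result G

/-- The number of queries that the algorithm makes when it is run on `G`. -/
def numQueries {n : ℕ} (G : WeightedGraph n) : CutQueryAlgorithm n → ℕ
  | output _ => 0
  | query S next => (next (G.cutValue S)).numQueries G + 1

/-- The algorithm estimates the max-cut value within a factor of `c`: on every weighted graph its
output is between `c` times the max-cut value and the max-cut value. -/
def EstimatesMaxCut {n : ℕ} (A : CutQueryAlgorithm n) (c : ℝ) : Prop :=
  ∀ G : WeightedGraph n, c * G.maxCut ≤ A.result G ∧ A.result G ≤ G.maxCut

end CutQueryAlgorithm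

/-- On `n` vertices, every deterministic adaptive algorithm that estimates the max-cut value within
a factor of `c` requires at least `q` cut queries in the worst case. -/
def RequiresCutQueries (n : ℕ) (c q : ℝ) : Prop :=
  ∀ A : CutQueryAlgorithm n, A.EstimatesMaxCut c →
    ∃ G : WeightedGraph n, q ≤ (A.numQueries G : ℝ)

/-! The adversary answers as the complete graph with unit weights, whose max-cut is at most `n ^ 2 /
4`. If the algorithm makes `q` queries there, a vector `z` in the cube can be chosen with sum zero
on the whole vertex set and on every queried set, and with at most `q + 1` coordinates off `±1`. The
graph with weights `1 - z i * z j` then gives the same answers, hence the same output, but has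
max-cut at least `n * (n - q - 1) / 2`. Comparing the two max-cuts yields `q ≥ n * (2 * c - 1) / (2
* c) - 1`, and the stated constants are at most `(2 * c - 1) / (2 * c)`. -/

/-- Finitely many linear conditions on the cube `[-1, 1]ⁿ` have a common solution in which at most
as many coordinates lie in the open interval `(-1, 1)` as there are conditions. -/
theorem exists_mem_cube_sum_eq_zero {n : ℕ} (l : List (Finset (Fin n))) :
    ∃ z : Fin n → ℝ, (∀ i, |z i| ≤ 1) ∧ (∀ S ∈ l, ∑ i ∈ S, z i = 0) ∧
      (Finset.univ.filter fun i => |z i| < 1).card ≤ l.length := by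
  classical
  let K : Set (Fin n → ℝ) := {z | (∀ i, |z i| ≤ 1) ∧ ∀ S ∈ l, ∑ i ∈ S, z i = 0}
  have hKc : IsCompact K := by
    refine (isCompact_univ_pi fun _ : Fin n => isCompact_Icc (a := (-1 : ℝ)) (b := 1)).of_isClosed_subset
      ?_ fun z hz i _ => abs_le.mp (hz.1 i)
    have h₁ : IsClosed {z : Fin n → ℝ | ∀ i, |z i| ≤ 1} := by
      simp only [Set.ofPred_forall]
      exact isClosed_iInter fun i => isClosed_le (by fun_prop) (by fun_prop)
    have h₂ : IsClosed {z : Fin n → ℝ | ∀ S ∈ l, ∑ i ∈ S, z i = 0} := by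
      simp only [Set.ofPred_forall]
      exact isClosed_iInter fun S => isClosed_iInter fun _ =>
        isClosed_eq (by fun_prop) (by fun_prop)
    exact h₁.inter h₂
  -- A maximiser of a strictly convex function is an extreme point, so it has few fractional
  -- coordinates.
  obtain ⟨z, hz, hmax⟩ := hKc.exists_isMaxOn ⟨0, by simp [K]⟩
    (f := fun z : Fin n → ℝ => ∑ i, z i ^ 2) (by fun_prop)
  refine ⟨z, hz.1, hz.2, ?_⟩
  by_contra! hcard
  let free := {i : Fin n // |z i| < 1}
  let extend : (free → ℝ) → Fin n → ℝ := fun y i => if h : |z i| < 1 then y ⟨i, h⟩ else 0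
  let φ : (free → ℝ) →ₗ[ℝ] (Fin l.length → ℝ) :=
    { toFun := fun y k => ∑ i ∈ l.get k, extend y i
      map_add' := fun x y => by
        ext k
        simp only [Pi.add_apply, ← Finset.sum_add_distrib]
        refine Finset.sum_congr rfl fun i _ => ?_
        by_cases h : |z i| < 1 <;> simp [extend, h]
      map_smul' := fun r y => by
        ext k
        simp only [Pi.smul_apply, smul_eq_mul, RingHom.id_apply, Finset.mul_sum]
        refine Finset.sum_congr rfl fun i _ => ?_
        by_cases h : |z i| < 1 <;> simp [extend, h] }
  -- More free coordinates than conditions: some nonzero direction supported on the free coordinates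
  -- preserves every condition.
  obtain ⟨y, hy, hy0⟩ := (Submodule.ne_bot_iff _).mp
    (LinearMap.ker_ne_bot_of_finrank_lt (f := φ) (by
      simpa [free, Fintype.card_subtype] using hcard))
  let u := extend y
  have hu : ∀ S ∈ l, ∑ i ∈ S, u i = 0 := by
    intro S hS
    obtain ⟨k, rfl⟩ := List.mem_iff_get.mp hS
    exact congrFun (LinearMap.mem_ker.mp hy) k
  have hu0 : 0 < ∑ i, u i ^ 2 := by
    obtain ⟨⟨i, hi⟩, hyi⟩ := Function.ne_iff.mp hy0
    refine Finset.sum_pos' (fun i _ => sq_nonneg _) ⟨i, Finset.mem_univ i, ?_⟩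
    have : u i ≠ 0 := by simpa [u, extend, hi] using hyi
    positivity
  have hcube : ∀ᶠ t : ℝ in 𝓝 0, ∀ i, |z i + t * u i| ≤ 1 := by
    refine Filter.eventually_all.mpr fun i => ?_
    by_cases h : |z i| < 1
    · have hc : Continuous fun t : ℝ => |z i + t * u i| := by fun_prop
      exact ((hc.tendsto 0).eventually_lt_const (by simpa using h)).mono fun _ => le_of_lt
    · have : u i = 0 := by simp [u, extend, h]
      simpa [this] using hz.1 i
  have hneg : ∀ᶠ t : ℝ in 𝓝 0, ∀ i, |z i + -t * u i| ≤ 1 :=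
    (continuous_neg.tendsto' (0 : ℝ) 0 neg_zero).eventually hcube
  obtain ⟨t, ⟨h₁, h₂⟩, ht⟩ := (((hcube.and hneg).filter_mono nhdsWithin_le_nhds).and
    (self_mem_nhdsWithin : ∀ᶠ t : ℝ in 𝓝[>] 0, t ∈ Set.Ioi 0)).exists
  have hmem : ∀ t : ℝ, (∀ i, |z i + t * u i| ≤ 1) → (fun i => z i + t * u i) ∈ K :=
    fun t ht => ⟨ht, fun S hS => by
      rw [Finset.sum_add_distrib, ← Finset.mul_sum, hz.2 S hS, hu S hS]; simp⟩
  have e₁ : ∑ i, (z i + t * u i) ^ 2 ≤ ∑ i, z i ^ 2 := hmax (hmem t h₁)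
  have e₂ : ∑ i, (z i + -t * u i) ^ 2 ≤ ∑ i, z i ^ 2 := hmax (hmem (-t) h₂)
  -- Parallelogram identity: one of `z ± t u` would beat the maximum.
  have e : ∑ i, (z i + t * u i) ^ 2 + ∑ i, (z i + -t * u i) ^ 2 =
      2 * ∑ i, z i ^ 2 + 2 * t ^ 2 * ∑ i, u i ^ 2 := by
    simp only [Finset.mul_sum, ← Finset.sum_add_distrib]
    exact Finset.sum_congr rfl fun i _ => by ring
  have : 0 < t ^ 2 * ∑ i, u i ^ 2 := mul_pos (pow_pos ht 2) hu0
  linarith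

namespace WeightedGraph

/-- The graph on `Fin n` in which distinct vertices `i` and `j` are joined with weight
`1 - z i * z j`. -/
noncomputable def perturbed {n : ℕ} (z : Fin n → ℝ) (hz : ∀ i, |z i| ≤ 1) : WeightedGraph n where
  weight i j := if i = j then 0 else 1 - z i * z j
  symm i j := by simp only [eq_comm (a := i), mul_comm (z i)]
  nonneg i j := by
    split_ifs
    · exact le_rfl
    · have : |z i * z j| ≤ 1 := by
        rw [abs_mul]
        exact mul_le_one₀ (hz i) (abs_nonneg _) (hz j)
      linarith [le_abs_self (z i * z j)]
  loopless i := if_pos rfl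

/-- The complete graph on `Fin n` with all weights equal to `1`. -/
noncomputable def complete (n : ℕ) : WeightedGraph n :=
  perturbed (fun _ => 0) (by simp)

theorem cutValue_le_maxCut {n : ℕ} (G : WeightedGraph n) (S : Finset (Fin n)) :
    G.cutValue S ≤ G.maxCut :=
  Finset.le_sup' G.cutValue (Finset.mem_univ S)

/-- As `z` sums to zero, its sums over `S` and `Sᶜ` are opposite, so the cross term becomes a
square. It vanishes exactly when `z` sums to zero on `S`. -/
theorem cutValue_perturbed {n : ℕ} (z : Fin n → ℝ) (hz : ∀ i, |z i| ≤ 1) (h0 : ∑ i, z i = 0)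
    (S : Finset (Fin n)) :
    (perturbed z hz).cutValue S = S.card * (n - S.card) + (∑ i ∈ S, z i) ^ 2 := by
  have h : (perturbed z hz).cutValue S = ∑ i ∈ S, ∑ j ∈ Sᶜ, (1 - z i * z j) :=
    Finset.sum_congr rfl fun i hi => Finset.sum_congr rfl fun j hj =>
      if_neg fun e : i = j => Finset.mem_compl.mp hj (e ▸ hi)
  have hc : ∑ j ∈ Sᶜ, z j = -∑ i ∈ S, z i := by
    linarith [Finset.sum_add_sum_compl S z]
  have hcard : ((Sᶜ.card : ℕ) : ℝ) = n - S.card := by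
    rw [Finset.card_compl, Fintype.card_fin, Nat.cast_sub (by simpa using S.card_le_univ)]
  rw [h]
  simp only [Finset.sum_sub_distrib, Finset.sum_const, nsmul_eq_mul, mul_one, hcard,
    ← Finset.mul_sum, ← Finset.sum_mul, hc]
  ring

theorem cutValue_complete {n : ℕ} (S : Finset (Fin n)) :
    (complete n).cutValue S = S.card * (n - S.card) := by
  rw [complete, cutValue_perturbed _ _ (by simp)]
  simp

theorem maxCut_complete_le (n : ℕ) : (complete n).maxCut ≤ (n : ℝ) ^ 2 / 4 :=
  Finset.sup'_le _ _ fun S _ => by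
    rw [cutValue_complete]
    nlinarith [sq_nonneg ((n : ℝ) - 2 * S.card)]

/-- Cut by the sign of `z`: each side carries half of `a = ∑ i, |z i|`, hence has at least `a / 2`
vertices. -/
theorem le_maxCut_perturbed {n : ℕ} (z : Fin n → ℝ) (hz : ∀ i, |z i| ≤ 1)
    (h0 : ∑ i, z i = 0) : n * (∑ i, |z i|) / 2 ≤ (perturbed z hz).maxCut := by
  classical
  set P : Finset (Fin n) := Finset.univ.filter fun i => 0 ≤ z i
  set a : ℝ := ∑ i, |z i|
  have hP : ∑ i ∈ P, |z i| = ∑ i ∈ P, z i :=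
    Finset.sum_congr rfl fun i hi => abs_of_nonneg (by simpa [P] using hi)
  have hPc : ∑ i ∈ Pᶜ, |z i| = -∑ i ∈ Pᶜ, z i := by
    rw [← Finset.sum_neg_distrib]
    exact Finset.sum_congr rfl fun i hi => abs_of_neg (by simpa [P] using hi)
  have ha : ∑ i ∈ P, |z i| + ∑ i ∈ Pᶜ, |z i| = a := Finset.sum_add_sum_compl P _
  have hs := Finset.sum_add_sum_compl P z
  have hcard : (P.card : ℝ) + Pᶜ.card = n := by
    exact_mod_cast (Finset.card_add_card_compl P).trans (Fintype.card_fin n)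
  have b₁ : ∑ i ∈ P, |z i| ≤ P.card := by
    simpa using Finset.sum_le_card_nsmul P _ 1 fun i _ => hz i
  have b₂ : ∑ i ∈ Pᶜ, |z i| ≤ Pᶜ.card := by
    simpa using Finset.sum_le_card_nsmul Pᶜ _ 1 fun i _ => hz i
  refine le_trans ?_ (cutValue_le_maxCut _ P)
  rw [cutValue_perturbed z hz h0, show ∑ i ∈ P, z i = a / 2 by linarith]
  -- With `p = P.card`, `(p - a/2) * (n - p - a/2)` equals `p * (n - p) + a^2/4 - n * a/2`.
  nlinarith [mul_nonneg (show 0 ≤ (P.card : ℝ) - a / 2 by linarith)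
    (show 0 ≤ (n : ℝ) - P.card - a / 2 by linarith)]

end WeightedGraph

namespace CutQueryAlgorithm

/-- The sets queried by the algorithm when it is run on `G`. -/
def queries {n : ℕ} (G : WeightedGraph n) : CutQueryAlgorithm n → List (Finset (Fin n))
  | output _ => []
  | query S next => S :: (next (G.cutValue S)).queries G

theorem length_queries {n : ℕ} (G : WeightedGraph n) (A : CutQueryAlgorithm n) :
    (A.queries G).length = A.numQueries G := by
  induction A with
  | output v => rfl
  | query S next ih => simp [queries, numQueries, ih]

theorem result_eq_of_cutValue_eq {n : ℕ} {G H : WeightedGraph n} (A : CutQueryAlgorithm n)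
    (h : ∀ S ∈ A.queries G, H.cutValue S = G.cutValue S) : A.result H = A.result G := by
  induction A with
  | output v => rfl
  | query S next ih =>
    simp only [queries, List.mem_cons, forall_eq_or_imp] at h
    simp only [result, h.1]
    exact ih _ h.2

open WeightedGraph in
theorem EstimatesMaxCut.le_numQueries {n : ℕ} {c : ℝ} (hc : 1 / 2 < c) {A : CutQueryAlgorithm n}
    (hA : A.EstimatesMaxCut c) :
    n * ((2 * c - 1) / (2 * c)) - 1 ≤ (A.numQueries (complete n) : ℝ) := by
  obtain rfl | hn := Nat.eq_zero_or_pos n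
  · have : (0 : ℝ) ≤ (A.numQueries (complete 0) : ℝ) := Nat.cast_nonneg _
    simp only [Nat.cast_zero, zero_mul]
    linarith
  -- The extra condition on `Finset.univ` forces total sum zero and costs the `- 1` in the bound.
  obtain ⟨z, hz, hS, hcard⟩ :=
    exists_mem_cube_sum_eq_zero (Finset.univ :: A.queries (complete n))
  rw [List.length_cons, length_queries] at hcard
  simp only [List.mem_cons, forall_eq_or_imp] at hS
  have hres : A.result (perturbed z hz) = A.result (complete n) :=
    A.result_eq_of_cutValue_eq fun S h => by
      rw [cutValue_perturbed z hz hS.1, cutValue_complete, hS.2 S h]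
      ring
  have hsum : (n : ℝ) - (A.numQueries (complete n) + 1) ≤ ∑ i, |z i| := by
    have h : ∑ i, (1 - |z i|) ≤ ((Finset.univ.filter fun i => |z i| < 1).card : ℝ) := by
      rw [Finset.card_filter, Nat.cast_sum]
      refine Finset.sum_le_sum fun i _ => ?_
      split_ifs with hi
      · simp
      · simpa using hi
    have h' : ((Finset.univ.filter fun i => |z i| < 1).card : ℝ) ≤
        A.numQueries (complete n) + 1 := by exact_mod_cast hcard
    simp only [Finset.sum_sub_distrib, Finset.sum_const, Finset.card_univ, Fintype.card_fin,
      nsmul_eq_mul, mul_one] at h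
    linarith
  have hn' : (0 : ℝ) < n := Nat.cast_pos.mpr hn
  have hc0 : 0 < c := by linarith
  have h₁ : c * (n * (∑ i, |z i|) / 2) ≤ (n : ℝ) ^ 2 / 4 :=
    calc c * (n * (∑ i, |z i|) / 2) ≤ c * (perturbed z hz).maxCut :=
          mul_le_mul_of_nonneg_left (le_maxCut_perturbed z hz hS.1) hc0.le
      _ ≤ A.result (complete n) := hres ▸ (hA (perturbed z hz)).1
      _ ≤ (n : ℝ) ^ 2 / 4 := (hA (complete n)).2.trans (maxCut_complete_le n)
  have h₂ : 2 * c * ∑ i, |z i| ≤ n := by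
    refine le_of_mul_le_mul_left ?_ hn'
    linarith
  have h₃ := mul_le_mul_of_nonneg_left hsum (show 0 ≤ 2 * c by linarith)
  rw [sub_le_iff_le_add, ← mul_div_assoc, div_le_iff₀ (by linarith)]
  linarith

end CutQueryAlgorithm

theorem sqrt_sub_sqrt_pow_four_div_le {c : ℝ} (h₁ : 1 / 2 < c) (h₂ : c < 1) :
    (Real.sqrt c - Real.sqrt (1 - c)) ^ 4 / (108 * c * (2 * c - 1)) ≤ (2 * c - 1) / (2 * c) := by
  have hc : 0 < 2 * c - 1 := by linarith
  set a := Real.sqrt c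
  set b := Real.sqrt (1 - c)
  have ha : a ^ 2 = c := Real.sq_sqrt (by linarith)
  have hb : b ^ 2 = 1 - c := Real.sq_sqrt (by linarith)
  have hb0 : 0 ≤ b := Real.sqrt_nonneg _
  have ha0 : 0 ≤ a := Real.sqrt_nonneg _
  have hab : b ≤ a := Real.sqrt_le_sqrt (by linarith)
  -- Since `0 ≤ b ≤ a`, `(a - b)^2 ≤ a^2 - b^2 = 2 * c - 1`.
  have h : (a - b) ^ 2 ≤ 2 * c - 1 := by nlinarith
  have h' : (a - b) ^ 4 ≤ (2 * c - 1) ^ 2 := by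
    calc (a - b) ^ 4 = ((a - b) ^ 2) ^ 2 := by ring
      _ ≤ (2 * c - 1) ^ 2 := pow_le_pow_left₀ (sq_nonneg _) h 2
  rw [div_le_div_iff₀ (by positivity) (by linarith)]
  nlinarith [mul_le_mul_of_nonneg_right h' (show 0 ≤ 2 * c by linarith),
    mul_nonneg (show 0 ≤ c by linarith) (sq_nonneg (2 * c - 1))]

theorem cube_div_lt_of_one_div_lt {c ε : ℝ} (hε : 0 < ε) (hε' : ε < 1)
    (h : 1 / (1 + ε ^ 2) < c) :
    (1 - ε) ^ 3 / (108 * (1 + ε)) < (2 * c - 1) / (2 * c) := by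
  have hc : 0 < c := lt_trans (by positivity) h
  have h₁ : 1 < c * (1 + ε ^ 2) := (div_lt_iff₀ (by positivity)).mp h
  -- The right side is `1 - 1 / (2 * c)`, and `1 / c < 1 + ε ^ 2`.
  have h₂ : (1 - ε ^ 2) / 2 < (2 * c - 1) / (2 * c) := by
    rw [div_lt_div_iff₀ two_pos (by positivity)]
    linarith
  refine lt_of_le_of_lt ?_ h₂
  have h₃ : (1 - ε) ^ 3 ≤ 1 - ε := by
    simpa using pow_le_pow_of_le_one (show 0 ≤ 1 - ε by linarith) (by linarith)
      (show 1 ≤ 3 by norm_num)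
  rw [div_le_div_iff₀ (by positivity) two_pos]
  nlinarith [mul_nonneg (sub_nonneg.mpr hε'.le) hε.le,
    mul_nonneg (sub_nonneg.mpr hε'.le) (sq_nonneg ε)]

theorem mainTheorem1 :
    (∀ c ε α : ℝ, 1 / 2 < c → c < 1 → 0 < ε → ε < 1 → 0 < α →
      1 / (1 + ε ^ 2) < c → α < (1 - ε) ^ 3 / (108 * (1 + ε)) →
      ∃ N : ℕ, ∀ n : ℕ, N ≤ n →
        ¬ ∃ A : CutQueryAlgorithm n,
          (∀ G : WeightedGraph n, (A.numQueries G : ℝ) ≤ α * n) ∧ A.EstimatesMaxCut c) ∧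
    (∀ c : ℝ, 1 / 2 < c → c < 1 →
      ∃ δ : ℕ → ℝ, Tendsto δ atTop (𝓝 0) ∧
        ∀ n : ℕ, RequiresCutQueries n c
          (n * ((Real.sqrt c - Real.sqrt (1 - c)) ^ 4 / (108 * c * (2 * c - 1)) - δ n))) ∧
    (∀ c : ℝ, 1 / 2 < c →
      ∃ k : ℝ, 0 < k ∧ ∃ N : ℕ, ∀ n : ℕ, N ≤ n → RequiresCutQueries n c (k * n)) := by
  refine ⟨fun c ε α hc _ hε hε' _ hcε hα => ?_, fun c hc hc' => ?_, fun c hc => ?_⟩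
  · have hlt := hα.trans (cube_div_lt_of_one_div_lt hε hε' hcε)
    set τ := (2 * c - 1) / (2 * c)
    obtain ⟨N, hN⟩ := exists_nat_gt (1 / (τ - α))
    refine ⟨N, fun n hn ⟨A, hq, hA⟩ => ?_⟩
    have h₁ : 1 < n * (τ - α) := (div_lt_iff₀ (sub_pos.mpr hlt)).mp
      (hN.trans_le (Nat.cast_le.mpr hn))
    have h₂ := hA.le_numQueries hc
    have h₃ := hq (WeightedGraph.complete n)
    linarith
  -- The error `1 / n`, multiplied by `n`, is exactly the lost query.
  · refine ⟨fun n => 1 / n, tendsto_one_div_atTop_nhds_zero_nat, fun n A hA => ?_⟩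
    refine ⟨WeightedGraph.complete n, ?_⟩
    obtain rfl | hn := Nat.eq_zero_or_pos n
    · simp
    refine le_trans ?_ (hA.le_numQueries hc)
    have hn' : (0 : ℝ) < n := Nat.cast_pos.mpr hn
    rw [mul_sub, mul_one_div_cancel hn'.ne']
    exact sub_le_sub_right
      (mul_le_mul_of_nonneg_left (sqrt_sub_sqrt_pow_four_div_le hc hc') hn'.le) 1
  · have hτ : 0 < (2 * c - 1) / (2 * c) := div_pos (by linarith) (by linarith)
    set τ := (2 * c - 1) / (2 * c)
    obtain ⟨N, hN⟩ := exists_nat_gt (1 / (τ / 2))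
    -- Half the rate is given up to absorb the `- 1` for large `n`.
    refine ⟨τ / 2, half_pos hτ, N, fun n hn A hA => ⟨WeightedGraph.complete n, ?_⟩⟩
    have h₁ : 1 < n * (τ / 2) := (div_lt_iff₀ (half_pos hτ)).mp
      (hN.trans_le (Nat.cast_le.mpr hn))
    have h₂ := hA.le_numQueries hc
    linarith
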